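/- Let $G$ be a locally compact second countable (Hausdorff) group, $H\subset G$ a closed subgroup, $\mu_G,\mu_H$ left Haar measures and $\Delta_G,\Delta_H$ the modular functions, normalised by $\mu(Eg)=\Delta(g)\mu(E)$. Put $\rho(h)=\Delta_H(h)/\Delta_G(h)$ for $h\in H$. Let $\pi$ be a strongly continuous unitary representation of $G$ on a separable complex Hilbert space $\mathcal H$ and $\sigma$ one of $H$ on a separable complex Hilbert space $\mathcal K$. Let $\mathcal G_\pi=\mathrm{span}\{\int_G f(g)\pi(g)u\,d\mu_G(g) : f\in C_c(G),\,u\in\mathcal H\}$ be the Gårding domain of $\pi$. A *weight function* is a continuous $\theta:G\to[0,\infty)$ such that $\int_H\theta(gh)\,d\mu_H(h)=1$ for all $g\in G$ and $CH\cap\operatorname{supp}\theta$ is compact for every compact $C\subset G$. Given such a $\theta$, $\mathcal H^{\rm ind}_\sigma$ is the space of classes of $\mu_G$-measurable $F:G\to\mathcal K$ such that for each $h\in H$, $F(gh)=\sqrt{\rho(h)}\,\sigma(h^{-1})F(g)$ for $\mu_G$-almost all $g$, and $\|F\|^2=\int_G\|F(g)\|^2\theta(g)\,d\mu_G(g)<\infty$;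 $G$ acts on it by $(\mathrm{ind}_aF)(g)=F(a^{-1}g)$ (the representation induced by $\sigma$). For a linear map $A:\mathcal G_\pi\to\mathcal K$ consider the conditions, with $v$ ranging over $\mathcal G_\pi$: * (S) $\sigma(h)Av=\sqrt{\rho(h)}\,A\pi(h)v$ for all $h\in H$ and all $v$; * (Q) there is $\beta>0$ with $\int_G\|A\pi(g^{-1})v\|^2\theta(g)\,d\mu_G(g)\le\beta\|v\|^2$ for all $v$; * (F) there are $0<\alpha\le\beta$ with $\alpha\|v\|^2\le\int_G\|A\pi(g^{-1})v\|^2\theta(g)\,d\mu_G(g)\le\beta\|v\|^2$ for all $v$; * (T) $\int_G\|A\pi(g^{-1})v\|^2\theta(g)\,d\mu_G(g)=\|v\|^2$ for all $v$. $A$ is *admissible for $\pi$ modulo $(H,\sigma)$* if (S) and (Q) hold and $g\mapsto A\pi(g^{-1})v$ is $\mu_G$-measurable for every $v$. Its *wavelet transform* $W_A$ is the unique bounded operator $\mathcal H\to\mathcal H^{\rm ind}_\sigma$ with $(W_Av)(g)=A\pi(g^{-1})v$ for $v\in\mathcal G_\pi$; it intertwines $\pi$ and $\mathrm{ind}$.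 The representation $\pi$ is *square-integrable modulo $(H,\sigma)$* if the following equivalent conditions hold: $\pi$ is equivalent to a sub-representation of $\mathrm{ind}$; some admissible map satisfies (T); some admissible map satisfies (F). **Corollary.** Let $A:\mathcal H\to\mathcal K$ be a bounded operator whose restriction to $\mathcal G_\pi$ satisfies (S). Then: 1. If $A\neq0$, then $G/H$ has a non-zero $G$-invariant Radon measure and $\Delta_G(h)=\Delta_H(h)$ for all $h\in H$. Moreover, for every weight function $\theta$: 2. If $A|_{\mathcal G_\pi}$ satisfies (Q), then $A|_{\mathcal G_\pi}$ is admissible, $W_A$ exists, is unique and intertwines $\pi$ with $\mathrm{ind}$, and for every $v\in\mathcal H$ (not only $v\in\mathcal G_\pi$) the element $W_Av$ of $\mathcal H^{\rm ind}_\sigma$ is represented by the continuous function $g\mapsto A\pi(g^{-1})v$. 3. If $A|_{\mathcal G_\pi}$ satisfies (F), then $\pi$ is square-integrable modulo $(H,\sigma)$ and modulo $(H,\pi|_H)$. -/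

import Mathlib

set_option linter.unusedSectionVars false
open MeasureTheory Measure Function
open scoped NNReal ENNReal Pointwise

namespace SqIntModSubgroup

/-! ### Unitary representations and the Gårding domain -/

/-- A strongly continuous unitary representation of `G` on `E`. -/
structure UnitaryRep (G E : Type*) [Group G] [TopologicalSpace G]
    [NormedAddCommGroup E] [InnerProductSpace ℂ E] where
  toHom : G →* (E ≃ₗᵢ[ℂ] E)
  continuous_apply : ∀ v : E, Continuous fun g => toHom g v

section Rep

variable {G E : Type*} [Group G] [TopologicalSpace G]
  [NormedAddCommGroup E] [InnerProductSpace ℂ E]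

instance : CoeFun (UnitaryRep G E) (fun _ => G → E ≃ₗᵢ[ℂ] E) := ⟨fun π => π.toHom⟩

/-- The restriction of a representation to a subgroup. -/
def UnitaryRep.restrict (π : UnitaryRep G E) (H : Subgroup G) : UnitaryRep H E where
  toHom := π.toHom.comp H.subtype
  continuous_apply v := (π.continuous_apply v).comp continuous_subtype_val

variable [MeasurableSpace G]

/-- `π(f) u = ∫ f(g) π(g) u dμ(g)`. -/
noncomputable def UnitaryRep.smear (π : UnitaryRep G E) (μ : Measure G) (f : G → ℂ) (u : E) : E :=
  ∫ g, f g • π g u ∂μ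

/-- The Gårding domain: the span of the vectors `π(f) u` with `f ∈ C_c(G)` and `u ∈ E`. -/
def UnitaryRep.garding (π : UnitaryRep G E) (μ : Measure G) : Submodule ℂ E :=
  Submodule.span ℂ {w | ∃ f : G → ℂ, Continuous f ∧ HasCompactSupport f ∧ ∃ u : E,
    w = π.smear μ f u}

theorem UnitaryRep.apply_mem_garding [IsTopologicalGroup G] [BorelSpace G] [CompleteSpace E]
    (π : UnitaryRep G E) (μ : Measure G) [μ.IsMulLeftInvariant] (g : G) {v : E}
    (hv : v ∈ π.garding μ) : π g v ∈ π.garding μ := by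
  induction hv using Submodule.span_induction with
  | mem w hw =>
    obtain ⟨f, hf, hfc, u, rfl⟩ := hw
    refine Submodule.subset_span ⟨fun x => f (g⁻¹ * x), by fun_prop,
      hfc.comp_homeomorph (Homeomorph.mulLeft g⁻¹), u, ?_⟩
    have h1 : π g (π.smear μ f u) = ∫ x, f x • π (g * x) u ∂μ := by
      have h2 := (π g).toContinuousLinearEquiv.integral_comp_comm (μ := μ) (fun x => f x • π x u)
      have h3 : π g (π.smear μ f u) = ∫ x, π g (f x • π x u) ∂μ := h2.symm
      rw [h3]
      congr 1
      ext x
      rw [map_smul, map_mul]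
      rfl
    rw [h1]
    have h4 := integral_mul_left_eq_self (μ := μ) (fun x => f (g⁻¹ * x) • π x u) g
    simpa [UnitaryRep.smear] using h4
  | zero => simp
  | add x y _ _ hx hy => rw [map_add]; exact add_mem hx hy
  | smul c x _ hx => rw [map_smul]; exact Submodule.smul_mem _ c hx

/-- The action of `G` on the Gårding domain. -/
noncomputable def UnitaryRep.gardingAct [IsTopologicalGroup G] [BorelSpace G] [CompleteSpace E]
    (π : UnitaryRep G E) (μ : Measure G) [μ.IsMulLeftInvariant] (g : G) :
    π.garding μ →ₗ[ℂ] π.garding μ :=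
  ((π g).toLinearEquiv.toLinearMap).restrict fun _ hv => π.apply_mem_garding μ g hv

end Rep

/-! ### Modular functions -/

section Modular

variable {G : Type*} [Group G] [TopologicalSpace G] [IsTopologicalGroup G] [LocallyCompactSpace G]

/-- The modular function `Δ` of `G`, normalised by `μ(E g) = Δ(g) μ(E)` for a left Haar measure
`μ`, i.e. `∫ f(x g⁻¹) dμ(x) = Δ(g) ∫ f dμ`. (Mathlib's `modularCharacter` is the inverse of it.) -/
noncomputable def modFun (g : G) : ℝ≥0 := (modularCharacter g)⁻¹

/-- `ρ(h) = Δ_H(h) / Δ_G(h)` for `h ∈ H`. -/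
noncomputable def modRatio (H : Subgroup G) [LocallyCompactSpace H] (h : H) : ℝ≥0 :=
  modFun h / modFun (h : G)

variable [SecondCountableTopology G] [T2Space G] [MeasurableSpace G] [BorelSpace G]

theorem lintegral_comp_mul_right (μ : Measure G) [μ.IsHaarMeasure] (f : G → ℝ≥0∞) (g : G) :
    ∫⁻ x, f (x * g) ∂μ = (modularCharacter g : ℝ≥0∞) * ∫⁻ x, f x ∂μ := by
  have h : map (· * g) μ = modularCharacter g • μ := map_right_mul_eq_modularCharacterFun_smul μ g
  have h2 : ∫⁻ x, f (x * g) ∂μ = ∫⁻ x, f x ∂(map (· * g) μ) :=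
    (lintegral_map_equiv f (MeasurableEquiv.mulRight g)).symm
  rw [h2, h, lintegral_smul_measure]
  rfl

theorem modularCharacter_ne_zero (g : G) : modularCharacter g ≠ 0 :=
  (modularCharacterFun_pos g).ne'

theorem exists_lintegral_pos (μ : Measure G) [μ.IsHaarMeasure] :
    ∃ k : G → ℝ≥0∞, Measurable k ∧ ∫⁻ x, k x ∂μ ≠ 0 ∧ ∫⁻ x, k x ∂μ ≠ ∞ := by
  obtain ⟨K, hK, hK1⟩ := exists_compact_mem_nhds (1 : G)
  refine ⟨K.indicator 1, measurable_one.indicator hK.measurableSet, ?_, ?_⟩ <;>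
    rw [lintegral_indicator_one hK.measurableSet]
  · exact (measure_pos_of_mem_nhds μ hK1).ne'
  · exact hK.measure_lt_top.ne

theorem measurable_modularCharacter : Measurable fun g : G => (modularCharacter g : ℝ≥0∞) := by
  obtain ⟨k, hk, h0, h1⟩ := exists_lintegral_pos (haar : Measure G)
  have : (fun g : G => (modularCharacter g : ℝ≥0∞)) =
      fun g => (∫⁻ x, k (x * g) ∂haar) / ∫⁻ x, k x ∂haar := by
    ext g
    rw [lintegral_comp_mul_right, ENNReal.mul_div_cancel_right h0 h1]
  rw [this]
  refine Measurable.div_const ?_ _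
  exact Measurable.lintegral_prod_left' (f := fun z : G × G => k (z.1 * z.2)) (by fun_prop)

/-- `∫ Δ(x)⁻¹ f(x⁻¹) dμ(x) = ∫ f dμ`. -/
theorem lintegral_modular_inv (μ : Measure G) [μ.IsHaarMeasure] {f : G → ℝ≥0∞}
    (hf : Measurable f) :
    ∫⁻ x, (modularCharacter x : ℝ≥0∞) * f x⁻¹ ∂μ = ∫⁻ x, f x ∂μ := by
  obtain ⟨k, hk, h0, h1⟩ := exists_lintegral_pos μ
  have key : ∀ m : G → ℝ≥0∞, Measurable m → (∀ x, m x⁻¹ * m x = 1) →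
      (∀ x, ∫⁻ y, k (y * x) ∂μ = m x * ∫⁻ y, k y ∂μ) →
      ∫⁻ x, m x * f x⁻¹ ∂μ = ∫⁻ x, f x ∂μ := by
    intro m hm hinv hmk
    suffices h : (∫⁻ x, k x ∂μ) * ∫⁻ x, m x * f x⁻¹ ∂μ = (∫⁻ x, k x ∂μ) * ∫⁻ x, f x ∂μ from
      (ENNReal.mul_right_inj h0 h1).1 h
    calc (∫⁻ x, k x ∂μ) * ∫⁻ y, m y * f y⁻¹ ∂μ
        = ∫⁻ x, ∫⁻ y, k x * (m (x⁻¹ * y) * f (x⁻¹ * y)⁻¹) ∂μ ∂μ := by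
          rw [← lintegral_mul_const _ hk]
          congr 1; ext x
          rw [lintegral_const_mul _ (by fun_prop),
            lintegral_mul_left_eq_self (fun y => m y * f y⁻¹) x⁻¹]
      _ = ∫⁻ y, ∫⁻ x, k x * (m (x⁻¹ * y) * f (x⁻¹ * y)⁻¹) ∂μ ∂μ :=
          lintegral_lintegral_swap (Measurable.aemeasurable (by unfold Function.uncurry; fun_prop))
      _ = ∫⁻ y, ∫⁻ x, k (y * x) * (m x⁻¹ * f x) ∂μ ∂μ := by
          congr 1; ext y
          rw [← lintegral_mul_left_eq_self _ y]
          simp [mul_assoc]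
      _ = ∫⁻ x, ∫⁻ y, k (y * x) * (m x⁻¹ * f x) ∂μ ∂μ :=
          lintegral_lintegral_swap (Measurable.aemeasurable (by unfold Function.uncurry; fun_prop))
      _ = ∫⁻ x, (∫⁻ y, k y ∂μ) * f x ∂μ := by
          congr 1; ext x
          rw [lintegral_mul_const _ (by fun_prop), hmk]
          calc _ = (m x⁻¹ * m x) * ((∫⁻ y, k y ∂μ) * f x) := by ring
            _ = _ := by rw [hinv, one_mul]
      _ = _ := lintegral_const_mul _ hf
  refine key _ measurable_modularCharacter (fun x => ?_) fun x => lintegral_comp_mul_right μ k x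
  rw [← ENNReal.coe_mul, ← map_mul, inv_mul_cancel, map_one, ENNReal.coe_one]

end Modular

/-! ### The weight function `θ` and the induced representation -/

section Induced

variable {G : Type*} [Group G] [TopologicalSpace G] [MeasurableSpace G]

/-- `θ : G → [0, ∞)` is continuous, `∫_H θ(gh) dμ_H(h) = 1` for every `g ∈ G`, and `KH ∩ supp θ`
is compact for every compact `K`. -/
structure IsTheta (H : Subgroup G) (μH : Measure H) (θ : G → ℝ) : Prop where
  continuous : Continuous θ
  nonneg : ∀ g, 0 ≤ θ g
  integral_eq_one : ∀ g : G, ∫ h : H, θ (g * h) ∂μH = 1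
  isCompact_inter : ∀ K : Set G, IsCompact K → IsCompact (K * (H : Set G) ∩ tsupport θ)

/-- The measure `θ μ_G`. -/
noncomputable def thetaMeasure (μG : Measure G) (θ : G → ℝ) : Measure G :=
  μG.withDensity fun g => ENNReal.ofReal (θ g)

variable [IsTopologicalGroup G] [LocallyCompactSpace G] {H : Subgroup G} [LocallyCompactSpace H]
  {K : Type*} [NormedAddCommGroup K] [InnerProductSpace ℂ K]

/-- The functions `F : G → K` whose classes form the space of the induced representation:
`F` is `μ_G`-measurable; for each `h ∈ H`, `F(gh) = √ρ(h) σ(h⁻¹) F(g)` for almost all `g`; and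
`∫ ‖F‖² θ dμ_G < ∞`. -/
structure IsInduced (μG : Measure G) (θ : G → ℝ) (σ : UnitaryRep H K) (F : G → K) : Prop where
  aestronglyMeasurable : AEStronglyMeasurable F μG
  covariant : ∀ h : H, ∀ᵐ g ∂μG,
    F (g * h) = ((√(modRatio H h : ℝ) : ℝ) : ℂ) • σ h⁻¹ (F g)
  lintegral_lt_top : ∫⁻ g, ‖F g‖ₑ ^ 2 ∂(thetaMeasure μG θ) < ∞

variable {μG : Measure G} {θ : G → ℝ} {σ : UnitaryRep H K} {F F' : G → K}

theorem IsInduced.memLp (hF : IsInduced μG θ σ F) : MemLp F 2 (thetaMeasure μG θ) := by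
  refine ⟨hF.aestronglyMeasurable.mono_ac (withDensity_absolutelyContinuous _ _), ?_⟩
  rw [eLpNorm_lt_top_iff_lintegral_rpow_enorm_lt_top (by norm_num) (by norm_num)]
  simpa using hF.lintegral_lt_top

theorem IsInduced.add (hF : IsInduced μG θ σ F) (hF' : IsInduced μG θ σ F') :
    IsInduced μG θ σ (F + F') where
  aestronglyMeasurable := hF.aestronglyMeasurable.add hF'.aestronglyMeasurable
  covariant h := by
    filter_upwards [hF.covariant h, hF'.covariant h] with g h1 h2
    simp [h1, h2]
  lintegral_lt_top := by
    have h := (hF.memLp.add hF'.memLp).2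
    rw [eLpNorm_lt_top_iff_lintegral_rpow_enorm_lt_top (by norm_num) (by norm_num)] at h
    simpa using h

theorem IsInduced.smul (c : ℂ) (hF : IsInduced μG θ σ F) : IsInduced μG θ σ (c • F) where
  aestronglyMeasurable := hF.aestronglyMeasurable.const_smul c
  covariant h := by
    filter_upwards [hF.covariant h] with g h1
    simp [h1, smul_comm c]
  lintegral_lt_top := by
    have h := (hF.memLp.const_smul c).2
    rw [eLpNorm_lt_top_iff_lintegral_rpow_enorm_lt_top (by norm_num) (by norm_num)] at h
    simpa using h

theorem IsInduced.zero : IsInduced μG θ σ (0 : G → K) where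
  aestronglyMeasurable := aestronglyMeasurable_zero
  covariant h := by simp
  lintegral_lt_top := by simp

variable (μG θ σ)

/-- The space of the induced representation, as a subspace of `L²(G, θ μ_G; K)`. -/
def Ind : Submodule ℂ (Lp K 2 (thetaMeasure μG θ)) where
  carrier := {u | ∃ F : G → K, IsInduced μG θ σ F ∧ u =ᵐ[thetaMeasure μG θ] F}
  add_mem' := by
    rintro u v ⟨F, hF, hu⟩ ⟨F', hF', hv⟩
    exact ⟨F + F', hF.add hF', (Lp.coeFn_add u v).trans (hu.add hv)⟩
  zero_mem' := ⟨0, IsInduced.zero, Lp.coeFn_zero _ _ _⟩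
  smul_mem' := by
    rintro c u ⟨F, hF, hu⟩
    exact ⟨c • F, hF.smul c, (Lp.coeFn_smul c u).trans (hu.const_smul c)⟩

variable {μG θ σ}

/-- The class of a function in the space of the induced representation. -/
noncomputable def IsInduced.toInd (hF : IsInduced μG θ σ F) : Ind μG θ σ :=
  ⟨hF.memLp.toLp F, F, hF, hF.memLp.coeFn_toLp⟩

theorem exists_indRep (u : Ind μG θ σ) : ∃ (F : G → K) (hF : IsInduced μG θ σ F),
    u = hF.toInd := by
  obtain ⟨u, F, hF, hu⟩ := u
  exact ⟨F, hF, Subtype.ext (Lp.ext (hu.trans hF.memLp.coeFn_toLp.symm))⟩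

/-- A function representing an element of the space of the induced representation. -/
noncomputable def indRep (u : Ind μG θ σ) : G → K := (exists_indRep u).choose

theorem isInduced_indRep (u : Ind μG θ σ) : IsInduced μG θ σ (indRep u) :=
  (exists_indRep u).choose_spec.choose

theorem toInd_indRep (u : Ind μG θ σ) : (isInduced_indRep u).toInd = u :=
  (exists_indRep u).choose_spec.choose_spec.symm

theorem IsInduced.norm_toInd (hF : IsInduced μG θ σ F) :
    ‖hF.toInd‖ = ((∫⁻ g, ‖F g‖ₑ ^ 2 ∂(thetaMeasure μG θ)) ^ (1 / 2 : ℝ)).toReal := by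
  have h1 : ‖hF.toInd‖ = (eLpNorm F 2 (thetaMeasure μG θ)).toReal := Lp.norm_toLp F hF.memLp
  rw [h1, eLpNorm_eq_lintegral_rpow_enorm_toReal (by norm_num) (by norm_num)]
  simp

variable [SecondCountableTopology G] [T2Space G] [BorelSpace G]

theorem lintegral_covariant_swap [μG.IsHaarMeasure] {T T' N : G → ℝ≥0∞} (_hT : Measurable T)
    (_hT' : Measurable T') (h : H)
    (hNc : ∀ᵐ g ∂μG, N (g * (h⁻¹ : H)) = (modRatio H h⁻¹ : ℝ≥0∞) * N g) :
    ∫⁻ g, T g * N g * T' (g * h) ∂μG =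
      ∫⁻ g, T' g * N g * ((modularCharacter h : ℝ≥0∞) * T (g * (h⁻¹ : H))) ∂μG := by
  have h1 := lintegral_comp_mul_right μG (fun g => T g * N g * T' (g * h)) ((h⁻¹ : H) : G)
  have h2 : ∫⁻ g, T g * N g * T' (g * h) ∂μG = (modularCharacter (h : G) : ℝ≥0∞) *
      ∫⁻ g, T (g * (h⁻¹ : H)) * N (g * (h⁻¹ : H)) * T' g ∂μG := by
    simp only [Subgroup.coe_inv, inv_mul_cancel_right] at h1 ⊢
    rw [h1, ← mul_assoc, ← ENNReal.coe_mul, ← map_mul, mul_inv_cancel, map_one,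
      ENNReal.coe_one, one_mul]
  rw [h2, ← lintegral_const_mul' _ _ ENNReal.coe_ne_top]
  refine lintegral_congr_ae ?_
  filter_upwards [hNc] with g hg
  rw [hg]
  have h3 : (modularCharacter (h : G) : ℝ≥0∞) * (modRatio H h⁻¹ : ℝ≥0∞) =
      (modularCharacter h : ℝ≥0∞) := by
    rw [← ENNReal.coe_mul]
    congr 1
    have e1 : modularCharacter ((h⁻¹ : H) : G) * modularCharacter (h : G) = 1 := by
      rw [← map_mul, ← Subgroup.coe_mul, inv_mul_cancel, Subgroup.coe_one, map_one]
    have e2 : modularCharacter h⁻¹ * modularCharacter h = 1 := by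
      rw [← map_mul, inv_mul_cancel, map_one]
    have e3 := eq_inv_of_mul_eq_one_left e1
    have e4 := eq_inv_of_mul_eq_one_left e2
    have hne := modularCharacter_ne_zero (h : G)
    rw [modRatio, modFun, modFun, e3, e4, inv_inv, inv_inv, div_eq_mul_inv, mul_comm,
      mul_assoc, inv_mul_cancel₀ hne, mul_one]
  calc _ = ((modularCharacter (h : G) : ℝ≥0∞) * (modRatio H h⁻¹ : ℝ≥0∞)) *
        (T (g * (h⁻¹ : H)) * N g * T' g) := by ring
    _ = _ := by rw [h3]; ring

theorem lintegral_covariant_eq [μG.IsHaarMeasure] {μH : Measure H} [μH.IsHaarMeasure]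
    {T T' N : G → ℝ≥0∞} (hT : Measurable T) (hT' : Measurable T')
    (J : ∀ g : G, ∫⁻ h : H, T (g * h) ∂μH = 1) (J' : ∀ g : G, ∫⁻ h : H, T' (g * h) ∂μH = 1)
    (hN : AEMeasurable N μG)
    (hNc : ∀ h : H, ∀ᵐ g ∂μG, N (g * h) = (modRatio H h : ℝ≥0∞) * N g) :
    ∫⁻ g, T g * N g ∂μG = ∫⁻ g, T' g * N g ∂μG := by
  have : SecondCountableTopology H :=
    TopologicalSpace.Subtype.secondCountableTopology (H : Set G)
  have hN1 : AEMeasurable (fun z : G × H => N z.1) (μG.prod μH) := hN.comp_fst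
  have h4 := measurable_modularCharacter (G := H)
  have s1 : ∫⁻ g, T g * N g ∂μG = ∫⁻ g, ∫⁻ h : H, T g * N g * T' (g * h) ∂μH ∂μG := by
    congr 1; ext g
    rw [lintegral_const_mul _ (by fun_prop), J', mul_one]
  have s2 : ∫⁻ g, ∫⁻ h : H, T g * N g * T' (g * h) ∂μH ∂μG =
      ∫⁻ h : H, ∫⁻ g, T g * N g * T' (g * h) ∂μG ∂μH := by
    refine lintegral_lintegral_swap ?_
    have m1 : Measurable fun z : G × H => T z.1 := by fun_prop
    have m2 : Measurable fun z : G × H => T' (z.1 * z.2) := by fun_prop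
    exact (m1.aemeasurable.mul hN1).mul m2.aemeasurable
  have s3 : ∫⁻ h : H, ∫⁻ g, T g * N g * T' (g * h) ∂μG ∂μH = ∫⁻ h : H, ∫⁻ g, T' g * N g *
      ((modularCharacter h : ℝ≥0∞) * T (g * (h⁻¹ : H))) ∂μG ∂μH :=
    lintegral_congr fun h => lintegral_covariant_swap hT hT' h (hNc h⁻¹)
  have s4 : ∫⁻ h : H, ∫⁻ g, T' g * N g *
      ((modularCharacter h : ℝ≥0∞) * T (g * (h⁻¹ : H))) ∂μG ∂μH = ∫⁻ g, ∫⁻ h : H, T' g * N g *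
      ((modularCharacter h : ℝ≥0∞) * T (g * (h⁻¹ : H))) ∂μH ∂μG := by
    refine (lintegral_lintegral_swap ?_).symm
    have m1 : Measurable fun z : G × H => T' z.1 := by fun_prop
    have m2 : Measurable fun z : G × H => T (z.1 * (z.2⁻¹ : H)) := by fun_prop
    have m3 : Measurable fun z : G × H => (modularCharacter z.2 : ℝ≥0∞) :=
      h4.comp measurable_snd
    exact (m1.aemeasurable.mul hN1).mul (m3.mul m2).aemeasurable
  rw [s1, s2, s3, s4]
  congr 1; ext g
  have h5 : Measurable fun h : H => T (g * h) := by fun_prop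
  have h6 : Measurable fun h : H => (modularCharacter h : ℝ≥0∞) * T (g * (h⁻¹ : H)) :=
    h4.mul (h5.comp measurable_inv)
  rw [lintegral_const_mul _ h6, lintegral_modular_inv μH h5, J, mul_one]

theorem lintegral_ofReal_eq_one {μH : Measure H} {η : G → ℝ} (hη0 : ∀ g, 0 ≤ η g)
    (hη1 : ∀ g : G, ∫ h : H, η (g * h) ∂μH = 1) (g : G) :
    ∫⁻ h : H, ENNReal.ofReal (η (g * h)) ∂μH = 1 := by
  rw [← ofReal_integral_eq_lintegral_ofReal _ (Filter.Eventually.of_forall fun _ => hη0 _), hη1,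
    ENNReal.ofReal_one]
  by_contra hni
  exact zero_ne_one ((integral_undef hni).symm.trans (hη1 g))

/-- The norm of a covariant function does not depend on the choice of `θ`. -/
theorem lintegral_theta_eq [μG.IsHaarMeasure] {μH : Measure H} [μH.IsHaarMeasure] {θ θ' : G → ℝ}
    (hθc : Continuous θ) (hθ0 : ∀ g, 0 ≤ θ g) (hθ1 : ∀ g : G, ∫ h : H, θ (g * h) ∂μH = 1)
    (hθc' : Continuous θ') (hθ0' : ∀ g, 0 ≤ θ' g) (hθ1' : ∀ g : G, ∫ h : H, θ' (g * h) ∂μH = 1)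
    {N : G → ℝ≥0∞} (hN : AEMeasurable N μG)
    (hNc : ∀ h : H, ∀ᵐ g ∂μG, N (g * h) = (modRatio H h : ℝ≥0∞) * N g) :
    ∫⁻ g, N g ∂(thetaMeasure μG θ) = ∫⁻ g, N g ∂(thetaMeasure μG θ') := by
  have hm : Measurable fun g => ENNReal.ofReal (θ g) := by fun_prop
  have hm' : Measurable fun g => ENNReal.ofReal (θ' g) := by fun_prop
  unfold thetaMeasure
  rw [lintegral_withDensity_eq_lintegral_mul₀ hm.aemeasurable hN,
    lintegral_withDensity_eq_lintegral_mul₀ hm'.aemeasurable hN]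
  exact lintegral_covariant_eq hm hm' (lintegral_ofReal_eq_one hθ0 hθ1)
    (lintegral_ofReal_eq_one hθ0' hθ1') hN hNc

theorem IsInduced.enorm_sq_covariant (hF : IsInduced μG θ σ F) (h : H) :
    ∀ᵐ g ∂μG, ‖F (g * h)‖ₑ ^ 2 = (modRatio H h : ℝ≥0∞) * ‖F g‖ₑ ^ 2 := by
  filter_upwards [hF.covariant h] with g hg
  rw [hg, enorm_smul, mul_pow, LinearIsometryEquiv.enorm_map]
  congr 1
  rw [← ofReal_norm, Complex.norm_real, Real.norm_of_nonneg (Real.sqrt_nonneg _),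
    ← ENNReal.ofReal_pow (Real.sqrt_nonneg _), Real.sq_sqrt (NNReal.coe_nonneg _),
    ENNReal.ofReal_coe_nnreal]

variable [μG.IsHaarMeasure] {μH : Measure H} [μH.IsHaarMeasure]

theorem IsInduced.lintegral_translate (hθ : IsTheta H μH θ) (hF : IsInduced μG θ σ F) (a : G) :
    ∫⁻ g, ‖F (a⁻¹ * g)‖ₑ ^ 2 ∂(thetaMeasure μG θ) = ∫⁻ g, ‖F g‖ₑ ^ 2 ∂(thetaMeasure μG θ) := by
  have hθc := hθ.continuous
  have hN : AEMeasurable (fun g => ‖F g‖ₑ ^ 2) μG := hF.aestronglyMeasurable.enorm.pow_const 2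
  have hN' : AEMeasurable (fun g => ‖F (a⁻¹ * g)‖ₑ ^ 2) μG :=
    hN.comp_quasiMeasurePreserving (measurePreserving_mul_left μG a⁻¹).quasiMeasurePreserving
  rw [lintegral_theta_eq (μH := μH) (θ' := fun g => θ (a * g)) hθ.continuous hθ.nonneg
    hθ.integral_eq_one (by fun_prop) (fun g => hθ.nonneg _)
    (fun g => by simpa [mul_assoc] using hθ.integral_eq_one (a * g)) hN hF.enorm_sq_covariant]
  unfold thetaMeasure
  rw [lintegral_withDensity_eq_lintegral_mul₀ (by fun_prop) hN,
    lintegral_withDensity_eq_lintegral_mul₀ (by fun_prop) hN', ← lintegral_mul_left_eq_self _ a]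
  simp

theorem IsInduced.translate (hθ : IsTheta H μH θ) (hF : IsInduced μG θ σ F) (a : G) :
    IsInduced μG θ σ fun g => F (a⁻¹ * g) where
  aestronglyMeasurable := hF.aestronglyMeasurable.comp_quasiMeasurePreserving
    (measurePreserving_mul_left μG a⁻¹).quasiMeasurePreserving
  covariant h := by
    have := (measurePreserving_mul_left μG a⁻¹).quasiMeasurePreserving.ae (hF.covariant h)
    simpa [mul_assoc] using this
  lintegral_lt_top := by
    rw [hF.lintegral_translate hθ a]
    exact hF.lintegral_lt_top

theorem IsInduced.toInd_add (hF : IsInduced μG θ σ F) (hF' : IsInduced μG θ σ F') :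
    (hF.add hF').toInd = hF.toInd + hF'.toInd := rfl

theorem IsInduced.toInd_smul (c : ℂ) (hF : IsInduced μG θ σ F) :
    (hF.smul c).toInd = c • hF.toInd := rfl

theorem IsInduced.norm_translate (hθ : IsTheta H μH θ) (hF : IsInduced μG θ σ F) (a : G) :
    ‖(hF.translate hθ a).toInd‖ = ‖hF.toInd‖ := by
  rw [norm_toInd, norm_toInd, hF.lintegral_translate hθ a]

/-- Translation is well defined on classes. -/
theorem IsInduced.translate_congr (hθ : IsTheta H μH θ) (hF : IsInduced μG θ σ F)
    (hF' : IsInduced μG θ σ F') (a : G) (h : hF.toInd = hF'.toInd) :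
    (hF.translate hθ a).toInd = (hF'.translate hθ a).toInd := by
  have hG := hF.add (hF'.smul (-1))
  have h0 : hG.toInd = 0 := by
    have : hG.toInd = hF.toInd + (-1 : ℂ) • hF'.toInd := rfl
    rw [this, h]; simp
  have h1 := hG.norm_translate hθ a
  rw [h0, norm_zero, norm_eq_zero] at h1
  have h2 : (hG.translate hθ a).toInd =
    (hF.translate hθ a).toInd + (-1 : ℂ) • (hF'.translate hθ a).toInd := rfl
  rw [h2, neg_one_smul, ← sub_eq_add_neg, sub_eq_zero] at h1
  exact h1

/-- The operator `(ind_a F)(g) = F(a⁻¹ g)`. -/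
noncomputable def indIsometry (σ : UnitaryRep H K) (hθ : IsTheta H μH θ) (a : G) :
    Ind μG θ σ →ₗᵢ[ℂ] Ind μG θ σ where
  toFun u := ((isInduced_indRep u).translate hθ a).toInd
  map_add' u v := by
    refine IsInduced.translate_congr hθ (isInduced_indRep (u + v))
      ((isInduced_indRep u).add (isInduced_indRep v)) a ?_
    rw [IsInduced.toInd_add (isInduced_indRep u) (isInduced_indRep v), toInd_indRep, toInd_indRep,
      toInd_indRep]
  map_smul' c u := by
    refine IsInduced.translate_congr hθ (isInduced_indRep (c • u)) ((isInduced_indRep u).smul c) a ?_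
    rw [IsInduced.toInd_smul c (isInduced_indRep u), toInd_indRep, toInd_indRep]
  norm_map' u := by
    have := (isInduced_indRep u).norm_translate hθ a
    rw [toInd_indRep] at this
    exact this

theorem indIsometry_toInd (hθ : IsTheta H μH θ) (a : G) (hF : IsInduced μG θ σ F) :
    indIsometry σ hθ a hF.toInd = (hF.translate hθ a).toInd :=
  IsInduced.translate_congr hθ _ hF a (toInd_indRep _)

theorem indIsometry_one (hθ : IsTheta H μH θ) (u : Ind μG θ σ) :
    indIsometry σ hθ 1 u = u := by
  obtain ⟨F, hF, rfl⟩ := (exists_indRep u)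
  rw [indIsometry_toInd]
  simp

theorem indIsometry_mul (hθ : IsTheta H μH θ) (a b : G) (u : Ind μG θ σ) :
    indIsometry σ hθ (a * b) u = indIsometry σ hθ a (indIsometry σ hθ b u) := by
  obtain ⟨F, hF, rfl⟩ := (exists_indRep u)
  rw [indIsometry_toInd, indIsometry_toInd, indIsometry_toInd]
  simp [mul_assoc]

/-- The representation `ind` of `G` induced by `σ`, acting by unitary operators on `Ind`. -/
noncomputable def ind (σ : UnitaryRep H K) (hθ : IsTheta H μH θ) :
    G →* (Ind μG θ σ ≃ₗᵢ[ℂ] Ind μG θ σ) where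
  toFun a :=
    { toLinearEquiv := LinearEquiv.ofLinearMap (indIsometry σ hθ a).toLinearMap
        (indIsometry σ hθ a⁻¹).toLinearMap
        (by ext1 u; simp [← indIsometry_mul, indIsometry_one])
        (by ext1 u; simp [← indIsometry_mul, indIsometry_one])
      norm_map' := fun u => (indIsometry σ hθ a).norm_map u }
  map_one' := by ext1 u; exact indIsometry_one hθ u
  map_mul' a b := by ext1 u; exact indIsometry_mul hθ a b u

/-! ### Admissible maps and square-integrability modulo `(H, σ)` -/

variable {E : Type*} [NormedAddCommGroup E] [InnerProductSpace ℂ E] [CompleteSpace E]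
  {π : UnitaryRep G E}

/-- The function `(W_A v)(g) = A π(g⁻¹) v`, for `v` in the Gårding domain of `π`. -/
noncomputable def orbitMap (A : π.garding μG →ₗ[ℂ] K) (v : π.garding μG) (g : G) : K :=
  A (π.gardingAct μG g⁻¹ v)

/-- Semi-invariance: `σ(h) A v = √ρ(h) A π(h) v` for all `h ∈ H` and `v` in the Gårding domain. -/
def IsSemiInvariant (σ : UnitaryRep H K) (A : π.garding μG →ₗ[ℂ] K) : Prop :=
  ∀ (h : H) (v : π.garding μG),
    σ h (A v) = ((√(modRatio H h : ℝ) : ℝ) : ℂ) • A (π.gardingAct μG (h : G) v)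

/-- `∫ ‖A π(g⁻¹) v‖² θ(g) dμ_G(g)`, with value in `[0, ∞]`. -/
noncomputable def energy (θ : G → ℝ) (A : π.garding μG →ₗ[ℂ] K) (v : π.garding μG) : ℝ≥0∞ :=
  ∫⁻ g, ‖orbitMap A v g‖ₑ ^ 2 ∂(thetaMeasure μG θ)

/-- `∫ ‖A π(g⁻¹) v‖² θ(g) dμ_G(g) ≤ β ‖v‖²` on the Gårding domain, for some `β > 0`. -/
def IsSquareBounded (θ : G → ℝ) (A : π.garding μG →ₗ[ℂ] K) : Prop :=
  ∃ β : ℝ, 0 < β ∧ ∀ v : π.garding μG, energy θ A v ≤ ENNReal.ofReal (β * ‖v‖ ^ 2)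

/-- `α ‖v‖² ≤ ∫ ‖A π(g⁻¹) v‖² θ(g) dμ_G(g) ≤ β ‖v‖²` on the Gårding domain, for some
`0 < α ≤ β`. -/
def IsFrame (θ : G → ℝ) (A : π.garding μG →ₗ[ℂ] K) : Prop :=
  ∃ α β : ℝ, 0 < α ∧ α ≤ β ∧ ∀ v : π.garding μG,
    ENNReal.ofReal (α * ‖v‖ ^ 2) ≤ energy θ A v ∧ energy θ A v ≤ ENNReal.ofReal (β * ‖v‖ ^ 2)

/-- `∫ ‖A π(g⁻¹) v‖² θ(g) dμ_G(g) = ‖v‖²` on the Gårding domain. -/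
def IsTightFrame (θ : G → ℝ) (A : π.garding μG →ₗ[ℂ] K) : Prop :=
  ∀ v : π.garding μG, energy θ A v = ENNReal.ofReal (‖v‖ ^ 2)

/-- `A` is an admissible map for `π` modulo `(H, σ)`. -/
structure IsAdmissible (θ : G → ℝ) (σ : UnitaryRep H K) (A : π.garding μG →ₗ[ℂ] K) : Prop where
  semiInvariant : IsSemiInvariant σ A
  aestronglyMeasurable : ∀ v : π.garding μG, AEStronglyMeasurable (orbitMap A v) μG
  squareBounded : IsSquareBounded θ A

/-- `W` is a bounded extension of `v ↦ W_A v` from the Gårding domain to the whole space. -/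
def IsWaveletTransform (A : π.garding μG →ₗ[ℂ] K) (W : E →L[ℂ] Ind μG θ σ) : Prop :=
  ∀ v : π.garding μG, ∃ hF : IsInduced μG θ σ (orbitMap A v), W (v : E) = hF.toInd

/-- `π` is equivalent to a sub-representation of `ind`: there is a linear isometry of `E` into the
space of `ind` (so onto a closed invariant subspace) that intertwines the two actions. -/
def IsSubrepOfInd (μG : Measure G) [μG.IsHaarMeasure] (π : UnitaryRep G E) (σ : UnitaryRep H K)
    (hθ : IsTheta H μH θ) : Prop :=
  ∃ W : E →ₗᵢ[ℂ] Ind μG θ σ, ∀ (g : G) (v : E), W (π g v) = ind σ hθ g (W v)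

/-- `π` is square-integrable modulo `(H, σ)`. The notion is given by any one of the three
conditions below, which are equivalent; all of them are required here, so that nothing depends on
the equivalence. -/
structure IsSquareIntegrableMod (μG : Measure G) [μG.IsHaarMeasure] (π : UnitaryRep G E)
    (σ : UnitaryRep H K) (hθ : IsTheta H μH θ) : Prop where
  subrep : IsSubrepOfInd μG π σ hθ
  tight : ∃ A : π.garding μG →ₗ[ℂ] K, IsAdmissible θ σ A ∧ IsTightFrame θ A
  frame : ∃ A : π.garding μG →ₗ[ℂ] K, IsAdmissible θ σ A ∧ IsFrame θ A

end Induced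

end SqIntModSubgroup

/-! Since `A` is bounded on all of `E` and the Gårding domain is dense, semi-invariance extends to
σ(h)A = √ρ(h) A π(h) on `E`. Both σ(h) and π(h) are unitary, so taking operator norms gives ‖A‖ =
√ρ(h) ‖A‖, and A ≠ 0 forces ρ = 1 (`modRatio_eq_one_of_semiInvariant`).

When ρ = 1, choose a positive measurable weight T whose integral over every left coset of H is 1,
and push T μ_G forward to G/H. Integrals of right H-invariant functions against T μ_G do not depend
on the choice of T (`lintegral_weight_eq`). Comparing T with a translate gives invariance. Comparing
it with a weight that is well behaved over a given compact set gives finiteness on compact sets.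

For the wavelet transform, each orbit function g ↦ A π(g⁻¹)v is continuous and exactly covariant.
Fatou's lemma carries the bound (Q) from the Gårding domain to every v (`lintegral_orbit_le`), so
W_A can be defined directly on `E` by its formula.

Under (F), W = W_A is bounded below, so |W| is invertible and T = |W|⁻¹ commutes with π. Then WT is
an isometric intertwiner, and it is the wavelet transform of the tight map AT
(`isSquareIntegrableMod_of_isFrame`). For (H, π|_H), replace A by |A|: it has the same norms, hence
the same frame bounds, and it commutes with π(h) for h ∈ H. -/

namespace SqIntModSubgroup

/-! ### Density of the Gårding domain -/

section Garding

variable {G E : Type*} [Group G] [TopologicalSpace G] [IsTopologicalGroup G]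
  [LocallyCompactSpace G] [T2Space G] [MeasurableSpace G] [BorelSpace G]
  [NormedAddCommGroup E] [InnerProductSpace ℂ E] [CompleteSpace E]

/-- The Gårding domain is dense. -/
theorem UnitaryRep.dense_garding (π : UnitaryRep G E) (μ : Measure G) [μ.IsHaarMeasure] :
    Dense (π.garding μ : Set E) := by
  intro v
  rw [Metric.mem_closure_iff]
  intro ε hε
  have hU : {g : G | ‖π g v - v‖ < ε / 2} ∈ nhds (1 : G) := by
    have hc : Continuous fun g : G => ‖π g v - v‖ :=
      ((π.continuous_apply v).sub continuous_const).norm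
    refine (isOpen_lt hc continuous_const).mem_nhds ?_
    simp only [Set.mem_ofPred_eq, map_one, LinearIsometryEquiv.coe_one, id_eq, sub_self, norm_zero]
    positivity
  obtain ⟨U, hUs, hUo, h1U⟩ := mem_nhds_iff.1 hU
  obtain ⟨f, hf1, hfs, hfc, hf01⟩ := exists_continuousMap_one_of_isCompact_subset_isOpen
    (isCompact_singleton (x := (1 : G))) hUo (Set.singleton_subset_iff.2 h1U)
  have hfcs : HasCompactSupport f := hfs
  have hf0 : ∀ x, 0 ≤ f x := fun x => (hf01 x).1
  have hfi : Integrable f μ := f.continuous.integrable_of_hasCompactSupport hfcs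
  have hpos : 0 < ∫ x, f x ∂μ := by
    refine f.continuous.integral_pos_of_hasCompactSupport_nonneg_nonzero hfcs hf0 (x := 1) ?_
    simp [hf1 rfl]
  set c : ℝ := ∫ x, f x ∂μ with hc
  -- Approximate identity: c⁻¹f is a bump of integral 1 supported where π(g)v is within ε/2 of v, so
  -- its average of π(g)v is also within ε/2 of v.
  refine ⟨π.smear μ (fun x => ((c⁻¹ * f x : ℝ) : ℂ)) v,
    Submodule.subset_span ⟨_, by fun_prop, ?_, v, rfl⟩, ?_⟩
  · exact (hfcs.mul_left (f := fun _ => c⁻¹)).comp_left Complex.ofReal_zero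
  have hi : Integrable (fun x => ((c⁻¹ * f x : ℝ) : ℂ) • π x v) μ := by
    refine Continuous.integrable_of_hasCompactSupport ?_ ?_
    · exact (by fun_prop : Continuous fun x => ((c⁻¹ * f x : ℝ) : ℂ)).smul (π.continuous_apply v)
    · exact ((hfcs.mul_left (f := fun _ => c⁻¹)).comp_left Complex.ofReal_zero).smul_right
  have hi' : Integrable (fun x => ((c⁻¹ * f x : ℝ) : ℂ) • v) μ :=
    ((hfi.const_mul c⁻¹).ofReal).smul_const v
  have hv : v = ∫ x, ((c⁻¹ * f x : ℝ) : ℂ) • v ∂μ := by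
    rw [integral_smul_const, integral_complex_ofReal, integral_const_mul, ← hc,
      inv_mul_cancel₀ hpos.ne', Complex.ofReal_one, one_smul]
  have hle : ‖∫ x, (((c⁻¹ * f x : ℝ) : ℂ) • v - ((c⁻¹ * f x : ℝ) : ℂ) • π x v) ∂μ‖ ≤
      ∫ x, c⁻¹ * f x * (ε / 2) ∂μ := by
    refine norm_integral_le_of_norm_le ((hfi.const_mul _).mul_const _) (.of_forall fun x => ?_)
    rw [← smul_sub, norm_smul, Complex.norm_real,
      Real.norm_of_nonneg (mul_nonneg (inv_nonneg.2 hpos.le) (hf0 x))]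
    by_cases hx : f x = 0
    · simp [hx]
    · refine mul_le_mul_of_nonneg_left ?_ (mul_nonneg (inv_nonneg.2 hpos.le) (hf0 x))
      rw [norm_sub_rev]
      exact (hUs (hfc (subset_tsupport _ hx))).le
  rw [integral_sub hi' hi, ← hv, integral_mul_const, integral_const_mul, ← hc,
    inv_mul_cancel₀ hpos.ne', one_mul] at hle
  rw [dist_eq_norm]
  exact hle.trans_lt (half_lt_self hε)

end Garding

/-! ### Coset weights and the invariant measure on G/H -/

section InvariantMeasure

variable {G : Type*} [Group G] [TopologicalSpace G] [IsTopologicalGroup G] [LocallyCompactSpace G]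
  [SecondCountableTopology G] [T2Space G] [MeasurableSpace G] [BorelSpace G] {H : Subgroup G}

theorem setLIntegral_eq_lintegral_mul_indicator {X : Type*} [MeasurableSpace X] {μ : Measure X}
    {S : Set X} (hS : MeasurableSet S) (f : X → ℝ≥0∞) :
    ∫⁻ x in S, f x ∂μ = ∫⁻ x, f x * S.indicator 1 x ∂μ := by
  rw [← lintegral_indicator hS]
  congr 1; ext x
  by_cases hx : x ∈ S <;> simp [hx]

/-- If gh₀ ∈ C, left translation by h₀⁻¹ moves the set on the left into C⁻¹C. The point is that the
bound is uniform in g. -/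
theorem measure_setOf_mul_mem_le (μH : Measure H) [μH.IsMulLeftInvariant] (C : Set G) (g : G) :
    μH {h : H | g * h ∈ C} ≤ μH (Subtype.val ⁻¹' (C⁻¹ * C)) := by
  rcases Set.eq_empty_or_nonempty {h : H | g * h ∈ C} with h0 | ⟨h0, hh0⟩
  · simp [h0]
  · rw [← measure_preimage_mul μH h0]
    refine measure_mono fun h hh => ?_
    refine Set.mem_mul.2 ⟨(g * h0)⁻¹, Set.inv_mem_inv.2 hh0, g * (h0 * h : H), hh, ?_⟩
    simp [mul_assoc]

theorem measure_val_preimage_lt_top (hH : IsClosed (H : Set G)) (μH : Measure H)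
    [IsFiniteMeasureOnCompacts μH] {C : Set G} (hC : IsCompact C) :
    μH (Subtype.val ⁻¹' C) < ∞ :=
  (hH.isClosedEmbedding_subtypeVal.isCompact_preimage hC).measure_lt_top

/-- A positive measurable function on `G` whose integral over each left coset of `H` is `1`. -/
theorem exists_pos_lintegral_coset_eq_one (hH : IsClosed (H : Set G)) (μH : Measure H)
    [μH.IsHaarMeasure] : ∃ T : G → ℝ≥0∞, Measurable T ∧ (∀ g, T g ≠ 0) ∧
      ∀ g : G, ∫⁻ h : H, T (g * h) ∂μH = 1 := by
  have : SecondCountableTopology H :=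
    TopologicalSpace.Subtype.secondCountableTopology (H : Set G)
  have : LocallyCompactSpace H := hH.locallyCompactSpace
  let Q : ℕ → Set G := compactCovering G
  have hQ : ∀ n, IsCompact (Q n) := isCompact_compactCovering G
  -- The coefficients δ n are positive, yet so small that ∑ δ n · μ_H(Q n⁻¹ Q n) < 1. Hence φ = ∑ δ
  -- n · 1_{Q n} is positive everywhere while its integral over every coset stays below 1.
  obtain ⟨δ, hδ0, hδ⟩ := ENNReal.exists_pos_tsum_mul_lt_of_countable one_ne_zero
    (fun n => μH (Subtype.val ⁻¹' ((Q n)⁻¹ * Q n)))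
    (fun n => (measure_val_preimage_lt_top hH μH ((hQ n).inv.mul (hQ n))).ne)
  let φ : G → ℝ≥0∞ := fun x => ∑' n, (Q n).indicator (fun _ => (δ n : ℝ≥0∞)) x
  have hφ : Measurable φ :=
    Measurable.tsum fun n => measurable_const.indicator (hQ n).measurableSet
  have hφ0 : ∀ x, φ x ≠ 0 := by
    intro x hx
    obtain ⟨n, hn⟩ := Set.mem_iUnion.1 ((iUnion_compactCovering G).symm ▸ Set.mem_univ x)
    have h := ENNReal.tsum_eq_zero.1 hx n
    rw [Set.indicator_of_mem hn] at h
    exact (hδ0 n).ne' (by simpa using h)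
  let Φ : G → ℝ≥0∞ := fun g => ∫⁻ h : H, φ (g * h) ∂μH
  have hΦ : Measurable Φ :=
    Measurable.lintegral_prod_right' (f := fun z : G × H => φ (z.1 * z.2)) (by fun_prop)
  have hΦ0 : ∀ g, Φ g ≠ 0 := by
    intro g h
    rw [lintegral_eq_zero_iff (by fun_prop)] at h
    have h2 : ∀ᵐ _ : H ∂μH, False := h.mono fun x hx => hφ0 _ hx
    rw [Filter.eventually_false_iff_eq_bot, ae_eq_bot] at h2
    exact NeZero.ne μH h2
  have hΦ1 : ∀ g, Φ g ≠ ∞ := by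
    intro g
    refine ne_top_of_le_ne_top ENNReal.one_ne_top (le_trans ?_ hδ.le)
    have hm : ∀ n, MeasurableSet {h : H | g * h ∈ Q n} := fun n =>
      (by fun_prop : Measurable fun h : H => g * h) (hQ n).measurableSet
    have : Φ g = ∑' n, ∫⁻ h : H, (Q n).indicator (fun _ => (δ n : ℝ≥0∞)) (g * h) ∂μH :=
      lintegral_tsum fun n => ((measurable_const.indicator (hQ n).measurableSet).comp
        (by fun_prop : Measurable fun h : H => g * h)).aemeasurable
    rw [this]
    refine ENNReal.tsum_le_tsum fun n => ?_
    have h3 : ∫⁻ h : H, (Q n).indicator (fun _ => (δ n : ℝ≥0∞)) (g * h) ∂μH =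
        δ n * μH {h : H | g * h ∈ Q n} := by
      rw [← lintegral_indicator_const (hm n)]
      rfl
    rw [h3, mul_comm]
    exact mul_le_mul_left (measure_setOf_mul_mem_le μH (Q n) g) _
  have hΦH : ∀ g (h : H), Φ (g * h) = Φ g := by
    intro g h
    have := lintegral_mul_left_eq_self (μ := μH) (fun x : H => φ (g * x)) h
    simpa [Φ, mul_assoc] using this
  -- Φ is constant on cosets with values in (0, ∞), so dividing by it normalises every coset
  -- integral to 1 and keeps the weight positive.
  refine ⟨fun g => φ g / Φ g, hφ.div hΦ, fun g => ENNReal.div_ne_zero.2 ⟨hφ0 g, hΦ1 g⟩,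
    fun g => ?_⟩
  simp only [hΦH, div_eq_mul_inv]
  rw [lintegral_mul_const _ (by fun_prop)]
  exact ENNReal.mul_inv_cancel (hΦ0 g) (hΦ1 g)

variable [LocallyCompactSpace H]

theorem modRatio_eq_one_iff (h : H) :
    modRatio H h = 1 ↔ modFun (h : G) = modFun h := by
  have h0 : modFun (h : G) ≠ 0 := inv_ne_zero (modularCharacter_ne_zero _)
  rw [modRatio, div_eq_one_iff_eq h0, eq_comm]

/-- If the modular functions agree on `H`, the integral over `G` of a function invariant under `H`
against a weight does not depend on the weight. -/
theorem lintegral_weight_eq {μG : Measure G} [μG.IsHaarMeasure] {μH : Measure H} [μH.IsHaarMeasure]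
    (hmod : ∀ h : H, modRatio H h = 1) {T T' N : G → ℝ≥0∞} (hT : Measurable T)
    (hT' : Measurable T') (J : ∀ g : G, ∫⁻ h : H, T (g * h) ∂μH = 1)
    (J' : ∀ g : G, ∫⁻ h : H, T' (g * h) ∂μH = 1)
    (hN : Measurable N) (hNH : ∀ g (h : H), N (g * h) = N g) :
    ∫⁻ g, T g * N g ∂μG = ∫⁻ g, T' g * N g ∂μG :=
  lintegral_covariant_eq hT hT' J J' hN.aemeasurable fun h => .of_forall fun g => by
    simp [hmod, hNH]

/-- The indicator of CH is right H-invariant, so T may be exchanged for any other weight. One that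
is bounded and compactly supported within CH makes the integral visibly finite. -/
theorem setLIntegral_weight_lt_top (hH : IsClosed (H : Set G)) {μG : Measure G} [μG.IsHaarMeasure]
    {μH : Measure H} [μH.IsHaarMeasure] (hmod : ∀ h : H, modRatio H h = 1) {T : G → ℝ≥0∞}
    (hT : Measurable T) (J : ∀ g : G, ∫⁻ h : H, T (g * h) ∂μH = 1) {C : Set G} (hC : IsCompact C) :
    ∫⁻ g in C * (H : Set G), T g ∂μG < ∞ := by
  have : SecondCountableTopology H :=
    TopologicalSpace.Subtype.secondCountableTopology (H : Set G)
  -- C is thickened to CV because a coset may meet C itself in a null set. Each coset in CH meets CV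
  -- in measure at least m = μ_H(V ∩ H) > 0.
  obtain ⟨V, hV, hV1⟩ := exists_compact_mem_nhds (1 : G)
  have hCV := hC.mul hV
  have hS : MeasurableSet (C * (H : Set G)) := (hH.mul_left_of_isCompact hC).measurableSet
  set S : Set G := C * (H : Set G) with hSdef
  have hSH : ∀ (g : G) (h : H), g * h ∈ S ↔ g ∈ S := by
    have key : ∀ (g : G) (h : H), g ∈ S → g * h ∈ S := by
      rintro _ h ⟨c, hc, k, hk, rfl⟩
      exact ⟨c, hc, k * h, H.mul_mem hk h.2, (mul_assoc _ _ _).symm⟩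
    exact fun g h => ⟨fun hg => by simpa using key _ h⁻¹ hg, key g h⟩
  let Φ : G → ℝ≥0∞ := fun g => ∫⁻ h : H, (C * V).indicator 1 (g * h) ∂μH
  have hind : Measurable ((C * V).indicator (1 : G → ℝ≥0∞)) :=
    measurable_one.indicator hCV.measurableSet
  have hΦ : Measurable Φ := Measurable.lintegral_prod_right'
    (f := fun z : G × H => (C * V).indicator (1 : G → ℝ≥0∞) (z.1 * z.2)) (by fun_prop)
  have hΦe : ∀ g, Φ g = μH {h : H | g * h ∈ C * V} := by
    intro g
    have hm : MeasurableSet {h : H | g * h ∈ C * V} :=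
      (by fun_prop : Measurable fun h : H => g * h) hCV.measurableSet
    rw [← lintegral_indicator_one hm]
    rfl
  have hΦH : ∀ g (h : H), Φ (g * h) = Φ g := by
    intro g h
    have := lintegral_mul_left_eq_self (μ := μH)
      (fun x : H => (C * V).indicator (1 : G → ℝ≥0∞) (g * x)) h
    simpa [Φ, mul_assoc] using this
  have hΦ1 : ∀ g, Φ g ≠ ∞ := fun g => by
    rw [hΦe]
    exact ((measure_setOf_mul_mem_le μH _ g).trans_lt
      (measure_val_preimage_lt_top hH μH (hCV.inv.mul hCV))).ne
  set m : ℝ≥0∞ := μH (Subtype.val ⁻¹' V) with hm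
  have hm0 : m ≠ 0 := by
    refine (measure_pos_of_mem_nhds μH (x := (1 : H)) ?_).ne'
    exact continuous_subtype_val.continuousAt.preimage_mem_nhds (by simpa using hV1)
  have hΦm : ∀ g ∈ S, m ≤ Φ g := by
    rintro _ ⟨c, hc, k, hk, rfl⟩
    have := hΦH c ⟨k, hk⟩
    simp only at this ⊢
    rw [this, hΦe]
    exact measure_mono fun h hh => Set.mul_mem_mul hc hh
  classical
  -- Off CH the old weight is kept, since the comparison needs coset integral 1 on every coset. CH
  -- is a union of cosets, so the two pieces do not interfere.
  let T' : G → ℝ≥0∞ := S.piecewise (fun g => (C * V).indicator 1 g / Φ g) T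
  have hT' : Measurable T' := Measurable.piecewise hS (hind.div hΦ) hT
  have J' : ∀ g : G, ∫⁻ h : H, T' (g * h) ∂μH = 1 := by
    intro g
    by_cases hg : g ∈ S
    · have e : ∀ h : H, T' (g * h) = (C * V).indicator 1 (g * h) * (Φ g)⁻¹ := fun h => by
        rw [← hΦH g h]
        exact Set.piecewise_eq_of_mem _ _ _ ((hSH g h).2 hg)
      simp only [e]
      rw [lintegral_mul_const _ (by fun_prop)]
      exact ENNReal.mul_inv_cancel
        (fun h0 => hm0 (le_antisymm (h0 ▸ hΦm g hg) bot_le)) (hΦ1 g)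
    · have e : ∀ h : H, T' (g * h) = T (g * h) := fun h =>
        Set.piecewise_eq_of_notMem _ _ _ (mt (hSH g h).1 hg)
      simp only [e, J]
  have hN : Measurable (S.indicator (1 : G → ℝ≥0∞)) := measurable_one.indicator hS
  have key := lintegral_weight_eq (μG := μG) hmod hT hT' J J' hN fun g h => by
    simp [Set.indicator, hSH]
  rw [setLIntegral_eq_lintegral_mul_indicator hS, key]
  calc ∫⁻ g, T' g * S.indicator 1 g ∂μG ≤ ∫⁻ g, (C * V).indicator (fun _ => m⁻¹) g ∂μG := by
        refine lintegral_mono fun g => ?_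
        by_cases hg : g ∈ S
        · have e : T' g = (C * V).indicator 1 g / Φ g := Set.piecewise_eq_of_mem _ _ _ hg
          simp only [e, Set.indicator_of_mem hg, Pi.one_apply, mul_one]
          by_cases hg' : g ∈ C * V
          · simp only [Set.indicator_of_mem hg', Pi.one_apply, one_div]
            exact ENNReal.inv_le_inv.2 (hΦm g hg)
          · simp [hg']
        · simp [hg]
    _ = m⁻¹ * μG (C * V) := lintegral_indicator_const hCV.measurableSet _
    _ < ∞ := ENNReal.mul_lt_top (ENNReal.inv_lt_top.2 (pos_iff_ne_zero.2 hm0)) hCV.measure_lt_top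

/-- If the modular functions of `G` and of the closed subgroup `H` agree on `H`, then `G ⧸ H`
carries a non-zero invariant measure that is finite on compact sets. -/
theorem exists_invariant_measure_quotient (hH : IsClosed (H : Set G))
    (hmod : ∀ h : H, modRatio H h = 1) :
    ∃ ν : Measure (G ⧸ H), ν ≠ 0 ∧ IsFiniteMeasureOnCompacts ν ∧
      SMulInvariantMeasure G (G ⧸ H) ν := by
  let μG : Measure G := haar
  let μH : Measure H := haar
  obtain ⟨T, hT, hT0, J⟩ := exists_pos_lintegral_coset_eq_one hH μH
  have hmk : Measurable (QuotientGroup.mk : G → G ⧸ H) := measurable_from_quotient.1 measurable_id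
  have hν : ∀ s : Set (G ⧸ H), MeasurableSet s →
      map QuotientGroup.mk (μG.withDensity T) s = ∫⁻ g in QuotientGroup.mk ⁻¹' s, T g ∂μG :=
    fun s hs => by rw [map_apply hmk hs, withDensity_apply _ (hmk hs)]
  refine ⟨map QuotientGroup.mk (μG.withDensity T), fun h0 => ?_, ⟨fun Q hQ => ?_⟩,
    ⟨fun a s hs => ?_⟩⟩
  · have h1 := hν Set.univ MeasurableSet.univ
    rw [h0] at h1
    simp only [coe_zero, Pi.zero_apply, Set.preimage_univ, restrict_univ] at h1
    have h2 := (lintegral_eq_zero_iff hT).1 h1.symm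
    have h3 : ∀ᵐ _ : G ∂μG, False := h2.mono fun x hx => hT0 _ hx
    rw [Filter.eventually_false_iff_eq_bot, ae_eq_bot] at h3
    exact NeZero.ne μG h3
  -- Compact sets of G/H lift to compact sets of G, because the quotient map is open and G is
  -- locally compact.
  · obtain ⟨C, hC, hQC⟩ : ∃ C : Set G, IsCompact C ∧ Q ⊆ QuotientGroup.mk '' C := by
      refine hQ.induction_on ⟨∅, isCompact_empty, Set.empty_subset _⟩
        (fun s t hst ⟨C, hC, hs⟩ => ⟨C, hC, hst.trans hs⟩)
        (fun s t ⟨C, hC, hs⟩ ⟨D, hD, ht⟩ => ⟨C ∪ D, hC.union hD, ?_⟩) fun x _ => ?_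
      · rw [Set.image_union]
        exact Set.union_subset_union hs ht
      · obtain ⟨g, rfl⟩ := QuotientGroup.mk_surjective x
        obtain ⟨C, hC, hCg⟩ := exists_compact_mem_nhds g
        exact ⟨_, mem_nhdsWithin_of_mem_nhds (QuotientGroup.isOpenMap_coe.image_mem_nhds hCg),
          C, hC, subset_rfl⟩
    have hpre : (QuotientGroup.mk ⁻¹' ((QuotientGroup.mk : G → G ⧸ H) '' C)) = C * (H : Set G) :=
      QuotientGroup.preimage_image_mk_eq_mul H C
    have hm : MeasurableSet ((QuotientGroup.mk : G → G ⧸ H) '' C) := by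
      refine measurableSet_quotient.2 ?_
      have hm' := (hH.mul_left_of_isCompact hC).measurableSet
      rw [← hpre] at hm'
      exact hm'
    refine (measure_mono hQC).trans_lt ?_
    rw [hν _ hm, hpre]
    exact setLIntegral_weight_lt_top hH hmod hT J hC
  · have hs' : MeasurableSet ((fun x : G ⧸ H => a • x) ⁻¹' s) := by
      refine measurableSet_quotient.2 ?_
      exact (measurable_const_mul a) (hmk hs)
    have hind : Measurable ((QuotientGroup.mk ⁻¹' s : Set G).indicator (1 : G → ℝ≥0∞)) :=
      measurable_one.indicator (hmk hs)
    -- Translating the set by a amounts to translating the weight, and T(a⁻¹ ·) is again a weight.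
    have key := lintegral_weight_eq (μG := μG) hmod (T' := fun g => T (a⁻¹ * g)) hT
      (by fun_prop) J (fun g => by simpa [mul_assoc] using J (a⁻¹ * g)) hind
      fun g h => by
        have e : (QuotientGroup.mk (g * h) : G ⧸ H) = QuotientGroup.mk g :=
          QuotientGroup.mk_mul_of_mem g h.2
        change s.indicator 1 (QuotientGroup.mk (g * h) : G ⧸ H) = s.indicator 1 (QuotientGroup.mk g)
        rw [e]
    rw [hν _ hs', hν s hs, setLIntegral_eq_lintegral_mul_indicator (hmk hs),
      setLIntegral_eq_lintegral_mul_indicator (hmk hs'), key]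
    refine Eq.trans (lintegral_congr fun g => ?_) (lintegral_mul_left_eq_self _ a)
    rw [inv_mul_cancel_left]
    rfl

end InvariantMeasure

/-! ### Absolute values of bounded operators and their commutants -/

section Polar

variable {E F : Type*} [NormedAddCommGroup E] [InnerProductSpace ℂ E] [CompleteSpace E]
  [NormedAddCommGroup F] [InnerProductSpace ℂ F] [CompleteSpace F]

/-- The absolute value `|X| = √(X† X)` of a bounded operator, with its commutation property. -/
theorem exists_absoluteValue (X : E →L[ℂ] F) : ∃ R : E →L[ℂ] E, IsSelfAdjoint R ∧
    R * R = X.adjoint ∘L X ∧ (∀ v, ‖R v‖ = ‖X v‖) ∧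
    ∀ U : E ≃ₗᵢ[ℂ] E, (∀ v, ‖X (U v)‖ = ‖X v‖) → ∀ v, R (U v) = U (R v) := by
  set S : E →L[ℂ] E := X.adjoint ∘L X with hS
  have hS0 : 0 ≤ S :=
    (ContinuousLinearMap.nonneg_iff_isPositive _).2 (ContinuousLinearMap.isPositive_adjoint_comp_self X)
  have hSX : ∀ v, inner ℂ (S v) v = ((‖X v‖ ^ 2 : ℝ) : ℂ) := fun v => by
    rw [hS, ContinuousLinearMap.comp_apply, ContinuousLinearMap.adjoint_inner_left,
      inner_self_eq_norm_sq_to_K]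
    norm_cast
  have hR : IsSelfAdjoint (CFC.sqrt S) := (CFC.sqrt_nonneg S).isSelfAdjoint
  refine ⟨CFC.sqrt S, hR, CFC.sqrt_mul_sqrt_self S hS0, fun v => ?_, fun U hU v => ?_⟩
  · have h1 : inner ℂ (S v) v = ((‖CFC.sqrt S v‖ ^ 2 : ℝ) : ℂ) := by
      conv_lhs => rw [← CFC.sqrt_mul_sqrt_self S hS0, mul_apply_eq_comp]
      rw [← ContinuousLinearMap.adjoint_inner_right, hR.adjoint_eq, inner_self_eq_norm_sq_to_K]
      norm_cast
    rw [hSX] at h1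
    exact ((sq_eq_sq₀ (norm_nonneg _) (norm_nonneg _)).1 (by exact_mod_cast h1)).symm
  · let u : E →L[ℂ] E := U.toContinuousLinearEquiv
    have hc : Commute S u := by
      -- U⁻¹SU and S have the same quadratic form ‖Xv‖², and over ℂ the quadratic form determines
      -- the operator.
      have h1 : (U.symm : E →ₗ[ℂ] E) ∘ₗ (S : E →ₗ[ℂ] E) ∘ₗ (U : E →ₗ[ℂ] E) = S := by
        refine (ext_inner_map _ _).1 fun x => ?_
        have h2 : inner ℂ (U.symm (S (U x))) x = inner ℂ (S (U x)) (U x) := by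
          rw [← U.inner_map_map, U.apply_symm_apply]
        have h3 := (h2.trans (hSX (U x))).trans ((congrArg _ (by rw [hU])).trans (hSX x).symm)
        exact h3
      ext x
      have h4 := congrArg U (LinearMap.congr_fun h1 x)
      exact (U.apply_symm_apply _).symm.trans h4
    -- The functional calculus carries commutation with S over to √S.
    have := (hc.cfcₙ_nnreal NNReal.sqrt)
    exact DFunLike.congr_fun this v

/-- A bounded operator that is bounded below becomes isometric after composing with a bounded
operator that commutes with all unitaries preserving `‖X v‖`. -/
theorem exists_normalizer (X : E →L[ℂ] F) {α : ℝ} (hα : 0 < α)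
    (hX : ∀ v, α * ‖v‖ ^ 2 ≤ ‖X v‖ ^ 2) : ∃ T : E →L[ℂ] E, (∀ v, ‖X (T v)‖ = ‖v‖) ∧
    ∀ U : E ≃ₗᵢ[ℂ] E, (∀ v, ‖X (U v)‖ = ‖X v‖) → ∀ v, T (U v) = U (T v) := by
  obtain ⟨R, hR, hRX, hRn, hRU⟩ := exists_absoluteValue X
  -- R² = X†X satisfies ⟨R²x, x⟩ ≥ α‖x‖², hence is invertible. As R commutes with itself, R is
  -- invertible too, and the normalizer is R⁻¹.
  have hu : IsUnit (R * R) := by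
    refine ContinuousLinearMap.isUnit_of_forall_le_norm_inner_map _ (c := ⟨α, hα.le⟩) hα fun x => ?_
    rw [hRX, ContinuousLinearMap.comp_apply, ContinuousLinearMap.adjoint_inner_left,
      inner_self_eq_norm_sq_to_K, norm_pow, RCLike.norm_ofReal, abs_norm]
    rw [mul_comm]
    exact hX x
  obtain ⟨w, hw⟩ := ((Commute.refl R).isUnit_mul_iff.1 hu).1
  have h1 : ∀ v, R ((w⁻¹ : (E →L[ℂ] E)ˣ).1 v) = v := fun v => by
    rw [← hw, ← mul_apply_eq_comp, Units.mul_inv, one_apply_eq_self]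
  have h2 : ∀ v, (w⁻¹ : (E →L[ℂ] E)ˣ).1 (R v) = v := fun v => by
    rw [← hw, ← mul_apply_eq_comp, Units.inv_mul, one_apply_eq_self]
  refine ⟨(w⁻¹ : (E →L[ℂ] E)ˣ).1, fun v => by rw [← hRn, h1], fun U hU v => ?_⟩
  rw [← h2 (U ((w⁻¹ : (E →L[ℂ] E)ˣ).1 v)), hRU U hU, h1]

end Polar

/-! ### Wavelet transforms of bounded semi-invariant operators -/

section Wavelet

variable {G : Type*} [Group G] [TopologicalSpace G] [IsTopologicalGroup G] [LocallyCompactSpace G]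
  [SecondCountableTopology G] [T2Space G] [MeasurableSpace G] [BorelSpace G]
  {H : Subgroup G} [LocallyCompactSpace H]
  {μG : Measure G} [μG.IsHaarMeasure] {μH : Measure H} [μH.IsHaarMeasure] {θ : G → ℝ}
  {E : Type*} [NormedAddCommGroup E] [InnerProductSpace ℂ E] [CompleteSpace E]
  {K : Type*} [NormedAddCommGroup K] [InnerProductSpace ℂ K] [CompleteSpace K]
  {π : UnitaryRep G E} {σ : UnitaryRep H K} {A : E →L[ℂ] K}

/-- Both sides are continuous in v and the Gårding domain is dense. This is where boundedness of `A`
first enters. -/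
theorem isSemiInvariant_domRestrict_iff :
    IsSemiInvariant σ (A.toLinearMap.domRestrict (π.garding μG)) ↔
      ∀ (h : H) (v : E), σ h (A v) = ((√(modRatio H h : ℝ) : ℝ) : ℂ) • A (π (h : G) v) := by
  refine ⟨fun hA h => ?_, fun hA h v => hA h v⟩
  refine congr_fun (Continuous.ext_on (π.dense_garding μG) ?_ ?_ fun v hv => hA h ⟨v, hv⟩)
  · exact (σ h).continuous.comp A.continuous
  · exact (A.continuous.comp (π (h : G)).continuous).const_smul _

/-- Composing `A` with unitaries on either side preserves its operator norm, so √ρ(h) must be 1 once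
0 < ‖A‖ < ∞. -/
theorem modRatio_eq_one_of_semiInvariant (hA0 : A ≠ 0)
    (hA : ∀ (h : H) (v : E), σ h (A v) = ((√(modRatio H h : ℝ) : ℝ) : ℂ) • A (π (h : G) v)) (h : H) :
    modRatio H h = 1 := by
  have hnorm : ∀ (h : H) v, ‖A v‖ = √(modRatio H h : ℝ) * ‖A (π (h : G) v)‖ := fun h v => by
    rw [← (σ h).norm_map, hA, norm_smul, Complex.norm_real, Real.norm_of_nonneg (Real.sqrt_nonneg _)]
  set r : ℝ := √(modRatio H h : ℝ) with hr
  have hr0 : 0 ≤ r := Real.sqrt_nonneg _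
  have hApos : 0 < ‖A‖ := norm_pos_iff.2 hA0
  have h1 : ‖A‖ ≤ r * ‖A‖ := A.opNorm_le_bound (by positivity) fun v => by
    rw [hnorm h v, mul_assoc]
    refine mul_le_mul_of_nonneg_left ((A.le_opNorm _).trans_eq ?_) hr0
    rw [(π (h : G)).norm_map]
  have h2 : r * ‖A‖ ≤ ‖A‖ := by
    rw [← Real.norm_of_nonneg hr0, ← norm_smul]
    refine (r • A).opNorm_le_bound hApos.le fun v => ?_
    -- Evaluating at π(h)⁻¹v turns the norm identity into the reverse bound √ρ(h)‖Av‖ ≤ ‖A‖‖v‖.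
    have h3 := hnorm h ((π (h : G)).symm v)
    rw [(π (h : G)).apply_symm_apply] at h3
    rw [_root_.smul_apply, norm_smul, Real.norm_of_nonneg hr0, ← h3]
    exact (A.le_opNorm _).trans_eq (by rw [LinearIsometryEquiv.norm_map])
  have h4 : r = 1 := mul_right_cancel₀ hApos.ne' ((le_antisymm h2 h1).trans (one_mul _).symm)
  rw [hr, Real.sqrt_eq_one] at h4
  exact_mod_cast h4

theorem continuous_orbit (π : UnitaryRep G E) (A : E →L[ℂ] K) (v : E) :
    Continuous fun g : G => A (π g⁻¹ v) :=
  A.continuous.comp ((π.continuous_apply v).comp continuous_inv)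

theorem aestronglyMeasurable_orbit (π : UnitaryRep G E) (A : E →L[ℂ] K) (v : E) (μ : Measure G) :
    AEStronglyMeasurable (fun g : G => A (π g⁻¹ v)) μ :=
  (continuous_orbit π A v).aestronglyMeasurable

theorem modRatio_inv_mul (h : H) : modRatio H h⁻¹ * modRatio H h = 1 := by
  have e : ∀ {L : Type _} [Group L] [TopologicalSpace L] [IsTopologicalGroup L]
      [LocallyCompactSpace L] (x : L), modFun x⁻¹ = (modFun x)⁻¹ ∧ modFun x ≠ 0 := by
    intro L _ _ _ _ x
    have h0 : modularCharacter x ≠ 0 := (modularCharacterFun_pos x).ne'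
    have h1 : modularCharacter x⁻¹ * modularCharacter x = 1 := by
      rw [← map_mul, inv_mul_cancel, map_one]
    exact ⟨by rw [modFun, modFun, eq_inv_of_mul_eq_one_left h1], inv_ne_zero h0⟩
  have h1 := e h
  have h2 := e (h : G)
  have h3 := h1.2
  have h4 := h2.2
  rw [modRatio, modRatio, Subgroup.coe_inv, h1.1, h2.1]
  field_simp

/-- Semi-invariance at h⁻¹ produces √ρ(h⁻¹), which cancels the covariance factor √ρ(h). Covariance
therefore holds at every g, not just almost everywhere. -/
theorem isInduced_orbit
    (hA : ∀ (h : H) (v : E), σ h (A v) = ((√(modRatio H h : ℝ) : ℝ) : ℂ) • A (π (h : G) v)) {v : E}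
    (hv : ∫⁻ g, ‖A (π g⁻¹ v)‖ₑ ^ 2 ∂(thetaMeasure μG θ) < ∞) :
    IsInduced μG θ σ fun g => A (π g⁻¹ v) where
  aestronglyMeasurable := aestronglyMeasurable_orbit π A v μG
  covariant h := .of_forall fun g => by
    rw [hA, smul_smul, ← Complex.ofReal_mul, ← Real.sqrt_mul (NNReal.coe_nonneg _),
      ← NNReal.coe_mul, mul_comm, modRatio_inv_mul, NNReal.coe_one, Real.sqrt_one,
      Complex.ofReal_one, one_smul, mul_inv_rev, map_mul]
    rfl
  lintegral_lt_top := hv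

theorem IsInduced.toInd_congr {F F' : G → K} (hF : IsInduced μG θ σ F)
    (hF' : IsInduced μG θ σ F') (h : F = F') : hF.toInd = hF'.toInd := by
  subst h; rfl

theorem IsInduced.ofReal_norm_toInd_sq {F : G → K} (hF : IsInduced μG θ σ F) :
    ENNReal.ofReal (‖hF.toInd‖ ^ 2) = ∫⁻ g, ‖F g‖ₑ ^ 2 ∂(thetaMeasure μG θ) := by
  rw [hF.norm_toInd, ← ENNReal.toReal_pow, ← ENNReal.rpow_natCast, ← ENNReal.rpow_mul]
  rw [Nat.cast_ofNat, one_div, inv_mul_cancel₀ two_ne_zero, ENNReal.rpow_one]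
  exact ENNReal.ofReal_toReal hF.lintegral_lt_top.ne

/-- Square-boundedness extends from the Gårding domain to the whole space. -/
theorem lintegral_orbit_le {β : ℝ} (hβ : ∀ v : π.garding μG,
    energy θ (A.toLinearMap.domRestrict (π.garding μG)) v ≤ ENNReal.ofReal (β * ‖v‖ ^ 2)) (v : E) :
    ∫⁻ g, ‖A (π g⁻¹ v)‖ₑ ^ 2 ∂(thetaMeasure μG θ) ≤ ENNReal.ofReal (β * ‖v‖ ^ 2) := by
  obtain ⟨x, hx, hxv⟩ := mem_closure_iff_seq_limit.1 (π.dense_garding μG v)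
  -- For Gårding vectors x n → v the integrands converge pointwise, because `A` is bounded; Fatou's
  -- lemma then passes the bound to v.
  have h1 : ∀ g : G, ‖A (π g⁻¹ v)‖ₑ ^ 2 =
      Filter.liminf (fun n => ‖A (π g⁻¹ (x n))‖ₑ ^ 2) Filter.atTop := fun g => by
    have hc : Continuous fun u : E => ‖A (π g⁻¹ u)‖ₑ ^ 2 :=
      (ENNReal.continuous_pow 2).comp (A.continuous.comp (π g⁻¹).continuous).enorm
    exact ((hc.tendsto v).comp hxv).liminf_eq.symm
  have h2 : Filter.Tendsto (fun n => ENNReal.ofReal (β * ‖x n‖ ^ 2)) Filter.atTop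
      (nhds (ENNReal.ofReal (β * ‖v‖ ^ 2))) :=
    ENNReal.tendsto_ofReal ((hxv.norm.pow 2).const_mul β)
  simp_rw [h1]
  refine (lintegral_liminf_le fun n => ?_).trans ?_
  · exact ((ENNReal.continuous_pow 2).comp (continuous_orbit π A (x n)).enorm).measurable
  · rw [← h2.liminf_eq]
    exact Filter.liminf_le_liminf (.of_forall fun n => hβ ⟨x n, hx n⟩)

/-- The wavelet transform of a bounded map. -/
theorem exists_waveletTransform
    (hA : ∀ (h : H) (v : E), σ h (A v) = ((√(modRatio H h : ℝ) : ℝ) : ℂ) • A (π (h : G) v))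
    (hQ : IsSquareBounded θ (A.toLinearMap.domRestrict (π.garding μG))) :
    ∃ W : E →L[ℂ] Ind μG θ σ, ∀ v : E, ∃ hF : IsInduced μG θ σ (fun g => A (π g⁻¹ v)),
      W v = hF.toInd := by
  obtain ⟨β, hβ0, hβ⟩ := hQ
  have hle := lintegral_orbit_le hβ
  have hF : ∀ v, IsInduced μG θ σ fun g => A (π g⁻¹ v) := fun v =>
    isInduced_orbit hA ((hle v).trans_lt ENNReal.ofReal_lt_top)
  let W₀ : E →ₗ[ℂ] Ind μG θ σ :=
    { toFun := fun v => (hF v).toInd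
      map_add' := fun u v => by
        rw [← IsInduced.toInd_add (hF u) (hF v)]
        exact IsInduced.toInd_congr _ _ (by ext g; simp)
      map_smul' := fun c v => by
        rw [RingHom.id_apply, ← IsInduced.toInd_smul c (hF v)]
        exact IsInduced.toInd_congr _ _ (by ext g; simp) }
  refine ⟨W₀.mkContinuous √β fun v => ?_, fun v => ⟨hF v, rfl⟩⟩
  have h1 := (hF v).ofReal_norm_toInd_sq.trans_le (hle v)
  rw [ENNReal.ofReal_le_ofReal_iff (by positivity)] at h1
  refine (sq_le_sq₀ (norm_nonneg _) (by positivity)).1 ?_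
  rwa [mul_pow, Real.sq_sqrt hβ0.le]

theorem waveletTransform_intertwines (hθ : IsTheta H μH θ) {W : E →L[ℂ] Ind μG θ σ}
    (hW : ∀ v : E, ∃ hF : IsInduced μG θ σ (fun g => A (π g⁻¹ v)), W v = hF.toInd) (g : G) (v : E) :
    W (π g v) = ind σ hθ g (W v) := by
  obtain ⟨hF, h1⟩ := hW v
  obtain ⟨hF', h2⟩ := hW (π g v)
  rw [h1, h2]
  refine Eq.trans ?_ (indIsometry_toInd hθ g hF).symm
  refine IsInduced.toInd_congr _ _ ?_
  ext x
  rw [mul_inv_rev, inv_inv, map_mul]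
  rfl

theorem isAdmissible_domRestrict
    (hA : ∀ (h : H) (v : E), σ h (A v) = ((√(modRatio H h : ℝ) : ℝ) : ℂ) • A (π (h : G) v))
    (hQ : IsSquareBounded θ (A.toLinearMap.domRestrict (π.garding μG))) :
    IsAdmissible θ σ (A.toLinearMap.domRestrict (π.garding μG)) :=
  ⟨isSemiInvariant_domRestrict_iff.2 hA, fun v => aestronglyMeasurable_orbit π A v μG, hQ⟩

theorem IsFrame.isSquareBounded {A : π.garding μG →ₗ[ℂ] K} (hA : IsFrame θ A) :
    IsSquareBounded θ A := by
  obtain ⟨α, β, hα, hαβ, h⟩ := hA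
  exact ⟨β, hα.trans_le hαβ, fun v => (h v).2⟩

theorem IsTightFrame.isFrame {A : π.garding μG →ₗ[ℂ] K} (hA : IsTightFrame θ A) : IsFrame θ A :=
  ⟨1, 1, one_pos, le_rfl, fun v => by simp [hA v]⟩

/-- Polar decomposition of the wavelet transform: precomposing with |W|⁻¹, which commutes with π,
turns the frame into a tight one without losing semi-invariance. -/
theorem isSquareIntegrableMod_of_isFrame (hθ : IsTheta H μH θ)
    (hA : ∀ (h : H) (v : E), σ h (A v) = ((√(modRatio H h : ℝ) : ℝ) : ℂ) • A (π (h : G) v))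
    (hF : IsFrame θ (A.toLinearMap.domRestrict (π.garding μG))) :
    IsSquareIntegrableMod μG π σ hθ := by
  have hQ := hF.isSquareBounded
  obtain ⟨W, hW⟩ := exists_waveletTransform hA hQ
  have hWi := waveletTransform_intertwines hθ hW
  obtain ⟨α, β, hα, -, hαβ⟩ := hF
  have hlow : ∀ v, α * ‖v‖ ^ 2 ≤ ‖W v‖ ^ 2 := by
    have hcl : IsClosed {v : E | α * ‖v‖ ^ 2 ≤ ‖W v‖ ^ 2} :=
      isClosed_le (by fun_prop) (by fun_prop)
    refine fun v => hcl.closure_subset_iff.2 (fun u hu => ?_) (π.dense_garding μG v)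
    obtain ⟨hI, hWu⟩ := hW u
    have h1 : ENNReal.ofReal (α * ‖u‖ ^ 2) ≤ ENNReal.ofReal (‖W u‖ ^ 2) := by
      rw [hWu, hI.ofReal_norm_toInd_sq]
      exact (hαβ ⟨u, hu⟩).1
    exact (ENNReal.ofReal_le_ofReal_iff (by positivity)).1 h1
  -- W is viewed as a map into the ambient L² space, whose completeness provides the adjoint;
  -- completeness of `Ind` is then not needed.
  obtain ⟨T, hT, hTU⟩ := exists_normalizer ((Ind μG θ σ).subtypeL ∘L W) hα hlow
  have hTn : ∀ v, ‖W (T v)‖ = ‖v‖ := hT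
  have hTπ : ∀ (g : G) v, T (π g v) = π g (T v) := fun g => hTU (π g) fun v => by
    have h1 : ‖W (π g v)‖ = ‖W v‖ := by rw [hWi, LinearIsometryEquiv.norm_map]
    exact h1
  have hA' : ∀ (h : H) (v : E),
      σ h ((A ∘L T) v) = ((√(modRatio H h : ℝ) : ℝ) : ℂ) • (A ∘L T) (π (h : G) v) := fun h v => by
    simp only [ContinuousLinearMap.comp_apply]
    rw [hA, hTπ]
  have htight : IsTightFrame θ ((A ∘L T).toLinearMap.domRestrict (π.garding μG)) := fun v => by
    obtain ⟨hI, hWv⟩ := hW (T v)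
    have h1 := hI.ofReal_norm_toInd_sq
    rw [← hWv, hTn] at h1
    -- As T commutes with π, the orbit function of AT at v is that of A at Tv, so its energy is
    -- ‖W(Tv)‖² = ‖v‖².
    refine Eq.trans (lintegral_congr fun g => ?_) h1.symm
    rw [← hTπ]
    rfl
  have hadm := isAdmissible_domRestrict hA' htight.isFrame.isSquareBounded
  refine ⟨⟨⟨(W ∘L T).toLinearMap, hTn⟩, fun g v => ?_⟩, ⟨_, hadm, htight⟩,
    ⟨_, hadm, htight.isFrame⟩⟩
  have h1 : W (T (π g v)) = ind σ hθ g (W (T v)) := by rw [hTπ, hWi]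
  exact h1

/-- A frame for `π` modulo `(H, σ)` can be replaced by one modulo `(H, π|_H)`. -/
theorem isSquareIntegrableMod_restrict_of_isFrame (hθ : IsTheta H μH θ)
    (hA : ∀ (h : H) (v : E), σ h (A v) = ((√(modRatio H h : ℝ) : ℝ) : ℂ) • A (π (h : G) v))
    (hF : IsFrame θ (A.toLinearMap.domRestrict (π.garding μG))) :
    IsSquareIntegrableMod μG π (π.restrict H) hθ := by
  obtain ⟨R, -, -, hRn, hRU⟩ := exists_absoluteValue A
  refine isSquareIntegrableMod_of_isFrame (A := R) hθ (fun h v => ?_) ?_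
  -- The identity ρ = 1 is available only for A ≠ 0; if A = 0 then |A| = 0 and semi-invariance is
  -- trivial.
  · by_cases hA0 : A = 0
    · have hR0 : ∀ v, R v = 0 := fun v => norm_eq_zero.1 (by rw [hRn, hA0]; simp)
      rw [hR0, hR0, map_zero, smul_zero]
    · have hρ := modRatio_eq_one_of_semiInvariant hA0 hA h
      rw [hρ, NNReal.coe_one, Real.sqrt_one, Complex.ofReal_one, one_smul]
      -- With ρ = 1, σ(h)A = Aπ(h) gives ‖Aπ(h)u‖ = ‖Au‖, so |A| commutes with π(h). That is
      -- semi-invariance with respect to π|_H.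
      refine (hRU (π (h : G)) (fun u => ?_) v).symm
      have h1 := hA h u
      rw [hρ, NNReal.coe_one, Real.sqrt_one, Complex.ofReal_one, one_smul] at h1
      rw [← h1, LinearIsometryEquiv.norm_map]
  · have he : ∀ v, energy θ (R.toLinearMap.domRestrict (π.garding μG)) v =
        energy θ (A.toLinearMap.domRestrict (π.garding μG)) v := fun v =>
      lintegral_congr fun g => by
        have h1 : ‖R (π g⁻¹ v)‖ₑ = ‖A (π g⁻¹ v)‖ₑ := by
          rw [← ofReal_norm, ← ofReal_norm, hRn]
        exact congrArg (· ^ 2) h1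
    obtain ⟨α, β, hα, hαβ, h⟩ := hF
    exact ⟨α, β, hα, hαβ, fun v => by rw [he]; exact h v⟩

end Wavelet

end SqIntModSubgroup

theorem mainTheorem6
    {G : Type*} [Group G] [TopologicalSpace G] [IsTopologicalGroup G] [LocallyCompactSpace G]
    [SecondCountableTopology G] [T2Space G] [MeasurableSpace G] [BorelSpace G]
    (H : Subgroup G) (_hH : IsClosed (H : Set G)) [LocallyCompactSpace H]
    (μG : Measure G) [μG.IsHaarMeasure] (μH : Measure H) [μH.IsHaarMeasure]
    {E : Type*} [NormedAddCommGroup E] [InnerProductSpace ℂ E] [CompleteSpace E]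
    [TopologicalSpace.SeparableSpace E]
    {K : Type*} [NormedAddCommGroup K] [InnerProductSpace ℂ K] [CompleteSpace K]
    [TopologicalSpace.SeparableSpace K]
    (π : SqIntModSubgroup.UnitaryRep G E) (σ : SqIntModSubgroup.UnitaryRep H K)
    (A : E →L[ℂ] K)
    (_hA : SqIntModSubgroup.IsSemiInvariant σ (A.toLinearMap.domRestrict (π.garding μG))) :
    (A ≠ 0 →
      (∃ ν : Measure (G ⧸ H), ν ≠ 0 ∧ IsFiniteMeasureOnCompacts ν ∧
        SMulInvariantMeasure G (G ⧸ H) ν) ∧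
      ∀ h : H, SqIntModSubgroup.modFun (h : G) = SqIntModSubgroup.modFun h) ∧
    ∀ (θ : G → ℝ) (hθ : SqIntModSubgroup.IsTheta H μH θ),
      (SqIntModSubgroup.IsSquareBounded θ (A.toLinearMap.domRestrict (π.garding μG)) →
        SqIntModSubgroup.IsAdmissible θ σ (A.toLinearMap.domRestrict (π.garding μG)) ∧
        ∃ W : E →L[ℂ] SqIntModSubgroup.Ind μG θ σ,
          SqIntModSubgroup.IsWaveletTransform (A.toLinearMap.domRestrict (π.garding μG)) W ∧
          (∀ W' : E →L[ℂ] SqIntModSubgroup.Ind μG θ σ,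
            SqIntModSubgroup.IsWaveletTransform (A.toLinearMap.domRestrict (π.garding μG)) W' →
              W' = W) ∧
          (∀ (g : G) (v : E), W (π g v) = SqIntModSubgroup.ind σ hθ g (W v)) ∧
          ∀ v : E, (Continuous fun g : G => A (π g⁻¹ v)) ∧
            ∃ hF : SqIntModSubgroup.IsInduced μG θ σ (fun g => A (π g⁻¹ v)), W v = hF.toInd) ∧
      (SqIntModSubgroup.IsFrame θ (A.toLinearMap.domRestrict (π.garding μG)) →
        SqIntModSubgroup.IsSquareIntegrableMod μG π σ hθ ∧
        SqIntModSubgroup.IsSquareIntegrableMod μG π (π.restrict H) hθ) := by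
  have hA := SqIntModSubgroup.isSemiInvariant_domRestrict_iff.1 _hA
  refine ⟨fun hA0 => ?_, fun θ hθ => ⟨fun hQ => ?_, fun hF =>
    ⟨SqIntModSubgroup.isSquareIntegrableMod_of_isFrame hθ hA hF,
      SqIntModSubgroup.isSquareIntegrableMod_restrict_of_isFrame hθ hA hF⟩⟩⟩
  · have hρ := SqIntModSubgroup.modRatio_eq_one_of_semiInvariant hA0 hA
    exact ⟨SqIntModSubgroup.exists_invariant_measure_quotient _hH hρ,
      fun h => (SqIntModSubgroup.modRatio_eq_one_iff h).1 (hρ h)⟩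
  · obtain ⟨W, hW⟩ := SqIntModSubgroup.exists_waveletTransform hA hQ
    refine ⟨SqIntModSubgroup.isAdmissible_domRestrict hA hQ, W, fun v => hW v, fun W' hW' => ?_,
      SqIntModSubgroup.waveletTransform_intertwines hθ hW,
      fun v => ⟨SqIntModSubgroup.continuous_orbit π A v, hW v⟩⟩
    -- Uniqueness: two bounded operators that agree on the dense Gårding domain coincide.
    refine DFunLike.coe_injective
      (Continuous.ext_on (π.dense_garding μG) W'.continuous W.continuous fun v hv => ?_)
    obtain ⟨_, h1⟩ := hW' ⟨v, hv⟩
    obtain ⟨_, h2⟩ := hW v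
    exact h1.trans h2.symm
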